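/- Let $(n_k)_{k\ge 0}$ be any strictly increasing sequence of integers, let $G$ be a compact, locally connected (Hausdorff) Abelian topological group, written additively, let $m$ be its normalized Haar measure, and let $f:G\to\mathbb R$ be an $m$-measurable function. Define $$\Gamma_{f,b}=\Big\{\alpha\in G:\ \limsup_{k\to\infty}\frac{|f(x+n_k\alpha)|}{k}<\infty\ \text{ for } m\text{-a.e. } x\in G\Big\}.$$ If $m(\Gamma_{f,b})>0$, then $f\in L^1(G)$. In particular, let $$M_N^{\alpha}f(x)=\frac1{N+1}\sum_{k=0}^{N}f(x+n_k\alpha)$$ be the non-conventional ergodic averages and let $$\Gamma_f=\big\{\alpha\in G:\ M_N^{\alpha}f(x)\text{ converges to a finite limit as } N\to\infty \text{ for } m\text{-a.e. } x\in G\big\}.$$ If $m(\Gamma_f)>0$, then $f\in L^1(G)$. -/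

import Mathlib

open MeasureTheory Filter Topology

namespace NonconvRotation

/-- The nonconventional ergodic average
`M_N^α f(x) = (1 / (N + 1)) ∑_{k=0}^N f(x + n_k α)`. -/
noncomputable def rotAverage {G : Type*} [AddCommGroup G] (n : ℕ → ℤ) (f : G → ℝ) (α : G)
    (N : ℕ) (x : G) : ℝ :=
  (1 / ((N : ℝ) + 1)) * ∑ k ∈ Finset.range (N + 1), f (x + n k • α)

/-- The `f`-rotation set `Γ_f`: those `α` for which `M_N^α f(x)` converges (to a real number)
as `N → ∞`, for `m`-almost every `x`. -/
def rotationSet {G : Type*} [AddCommGroup G] [MeasurableSpace G] (m : Measure G)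
    (n : ℕ → ℤ) (f : G → ℝ) : Set G :=
  {α | ∀ᵐ x ∂m, ∃ c : ℝ, Tendsto (fun N : ℕ => rotAverage n f α N x) atTop (𝓝 c)}

/-- The set `Γ_{f,b}`: those `α` for which `limsup_k |f(x + n_k α)| / k < ∞` for `m`-almost
every `x`. The upper limit is taken in the extended reals; the value at `k = 0` is irrelevant. -/
def rotationSetBdd {G : Type*} [AddCommGroup G] [MeasurableSpace G] (m : Measure G)
    (n : ℕ → ℤ) (f : G → ℝ) : Set G :=
  {α | ∀ᵐ x ∂m,
    limsup (fun k : ℕ => ((|f (x + n k • α)| / (k : ℝ) : ℝ) : EReal)) atTop < ⊤}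

end NonconvRotation

open ProbabilityTheory
open scoped ENNReal ComplexConjugate

/-! Suppose `f` is not integrable. Then the level sets `{|f| > M k}` have infinite total measure for
every `M > 0`. In a compact divisible group, multiplication by a nonzero integer is a surjective
endomorphism, so it preserves Haar measure. Since the `n k` are distinct, the events `x + n k • α ∈
E k` are therefore pairwise independent in `(x, α)`, each with the measure of `E k`. Borel–Cantelli
(`ae_frequently_mem_of_pairwise_indep`) makes almost every orbit exceed `M k` infinitely often, for
almost every `α`, so the limsup is infinite.

Local connectedness makes the identity component `H` open, hence of finite index, and a compact
connected group is divisible (`zsmul_surjective_of_connected`). The argument runs on `H` for each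
coset of rotations, after a pigeonhole selects a coset of starting points that carries infinite mass
for all `M`.

Divisibility reduces to the triviality of a compact connected group of bounded exponent. There
finitely many points generate a finite subgroup, and connectedness makes all Fourier coefficients of
a suitable continuous function small on dense finite subgroups. This contradicts a lower bound on
its autocorrelation that does not depend on the subgroup.

The statement on averages follows because each term of a sequence is recovered from two consecutive
averages. -/

/-! ### Finite Fourier analysis. -/

/-- If all Fourier coefficients of a real function on a finite abelian group are small, then so is
the mean square of its autocorrelation. -/
theorem sum_sq_autocorrelation_le {F : Type*} [AddCommGroup F] [Fintype F] (f : F → ℝ) (η : ℝ)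
    (h : ∀ χ : AddChar F ℂ, ‖∑ w, (f w : ℂ) * χ w‖ ≤ η * Fintype.card F) :
    ∑ v, (∑ w, f (w + v) * f w) ^ 2 ≤ η ^ 2 * (Fintype.card F : ℝ) ^ 2 * ∑ w, f w ^ 2 := by
  classical
  set N : ℝ := (Fintype.card F : ℝ) with hN
  have hN0 : 0 < N := by simp [hN, Fintype.card_pos]
  set A : AddChar F ℂ → ℂ := fun χ => ∑ w, (f w : ℂ) * χ w with hA
  set c : F → ℝ := fun v => ∑ w, f (w + v) * f w with hc
  have hconj (χ : AddChar F ℂ) : conj (A χ) = ∑ w, (f w : ℂ) * χ (-w) := by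
    simp [hA, AddChar.map_neg_eq_conj]
  have hAA (χ : AddChar F ℂ) : ((‖A χ‖ ^ 2 : ℝ) : ℂ) =
      ∑ w, ∑ w', (f w : ℂ) * f w' * χ (w - w') := by
    rw [Complex.ofReal_pow, ← Complex.mul_conj', hconj, hA, Finset.sum_mul_sum]
    refine Finset.sum_congr rfl fun w _ => Finset.sum_congr rfl fun w' _ => ?_
    rw [sub_eq_add_neg, AddChar.map_add_eq_mul]; ring
  -- Fourier inversion by orthogonality: the transform of the autocorrelation `c` is the power
  -- spectrum `‖A χ‖ ^ 2`.
  have hinv (v : F) : ∑ χ : AddChar F ℂ, ((‖A χ‖ ^ 2 : ℝ) : ℂ) * χ v = N * c v := by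
    calc ∑ χ : AddChar F ℂ, ((‖A χ‖ ^ 2 : ℝ) : ℂ) * χ v
        = ∑ χ : AddChar F ℂ, ∑ w, ∑ w', (f w : ℂ) * f w' * χ (w + v - w') := by
          refine Finset.sum_congr rfl fun χ _ => ?_
          rw [hAA, Finset.sum_mul]
          refine Finset.sum_congr rfl fun w _ => ?_
          rw [Finset.sum_mul]
          refine Finset.sum_congr rfl fun w' _ => ?_
          rw [mul_assoc, ← AddChar.map_add_eq_mul]; congr 2; abel
      _ = ∑ w, ∑ w', (f w : ℂ) * f w' * ∑ χ : AddChar F ℂ, χ (w + v - w') := by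
          rw [Finset.sum_comm]
          refine Finset.sum_congr rfl fun w _ => ?_
          rw [Finset.sum_comm]
          refine Finset.sum_congr rfl fun w' _ => ?_
          rw [Finset.mul_sum]
      _ = ∑ w, (N : ℂ) * ((f (w + v) : ℂ) * f w) := by
          refine Finset.sum_congr rfl fun w _ => ?_
          rw [Finset.sum_eq_single (w + v)]
          · simp [hN]; ring
          · intro w' _ hw'
            rw [AddChar.sum_apply_eq_ite, if_neg (by rwa [sub_eq_zero, eq_comm]), mul_zero]
          · simp
      _ = N * c v := by rw [← Finset.mul_sum]; simp [hc]
  have hdual (χ : AddChar F ℂ) : ∑ v, (c v : ℂ) * χ v = ((‖A χ‖ ^ 2 : ℝ) : ℂ) := by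
    rw [hAA, Finset.sum_comm]
    simp only [hc, Complex.ofReal_sum, Finset.sum_mul, Complex.ofReal_mul]
    rw [Finset.sum_comm]
    refine Finset.sum_congr rfl fun w _ => ?_
    refine Fintype.sum_equiv (Equiv.addLeft w) _ _ fun v => ?_
    simp
  -- Plancherel for `c` produces the fourth moment of the spectrum.
  have key : N * ∑ v, c v ^ 2 = ∑ χ, (‖A χ‖ ^ 2) ^ 2 := by
    have : (N : ℂ) * ∑ v, (c v : ℂ) ^ 2 = ∑ χ, ((‖A χ‖ ^ 2 : ℝ) : ℂ) ^ 2 := by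
      calc (N : ℂ) * ∑ v, (c v : ℂ) ^ 2 = ∑ v, (c v : ℂ) * (N * c v) := by
            rw [Finset.mul_sum]; exact Finset.sum_congr rfl fun _ _ => by ring
        _ = ∑ χ, ((‖A χ‖ ^ 2 : ℝ) : ℂ) * ∑ v, (c v : ℂ) * χ v := by
            simp_rw [← hinv, Finset.mul_sum]
            rw [Finset.sum_comm]
            exact Finset.sum_congr rfl fun _ _ => Finset.sum_congr rfl fun _ _ => by ring
        _ = _ := by simp_rw [hdual]; exact Finset.sum_congr rfl fun _ _ => by ring
    exact_mod_cast this
  have hpars : ∑ χ, ‖A χ‖ ^ 2 = N * ∑ w, f w ^ 2 := by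
    have := hinv 0
    simp only [AddChar.map_zero_eq_one, mul_one, hc, add_zero] at this
    have h2 : ∑ w, f w ^ 2 = ∑ w, f w * f w := Finset.sum_congr rfl fun _ _ => sq _
    rw [h2]
    exact_mod_cast this
  refine le_of_mul_le_mul_left ?_ hN0
  calc N * ∑ v, c v ^ 2 = ∑ χ, (‖A χ‖ ^ 2) ^ 2 := key
    _ ≤ ∑ χ, (η * N) ^ 2 * ‖A χ‖ ^ 2 := by
        refine Finset.sum_le_sum fun χ _ => ?_
        rw [sq (‖A χ‖ ^ 2)]
        gcongr
        exact h χ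
    _ = N * (η ^ 2 * N ^ 2 * ∑ w, f w ^ 2) := by rw [← Finset.mul_sum, hpars]; ring

/-! ### Divisibility of compact connected groups. -/

/-- Roots of unity of a given order are isolated from `1`. -/
theorem exists_pos_le_norm_sub_one_of_pow_eq_one {d : ℕ} (hd : 0 < d) :
    ∃ c > 0, ∀ z : ℂ, z ^ d = 1 → z ≠ 1 → c ≤ ‖z - 1‖ := by
  have hfin : {z : ℂ | z ^ d = 1 ∧ z ≠ 1}.Finite := by
    refine (Polynomial.nthRoots d (1 : ℂ)).toFinset.finite_toSet.subset fun z hz => ?_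
    simpa [Polynomial.mem_nthRoots hd] using hz.1
  have : {z : ℂ | z ^ d = 1 ∧ z ≠ 1}ᶜ ∈ 𝓝 (1 : ℂ) := hfin.isClosed.isOpen_compl.mem_nhds (by simp)
  obtain ⟨c, hc, hsub⟩ := Metric.mem_nhds_iff.1 this
  refine ⟨c, hc, fun z hz hz1 => ?_⟩
  by_contra! hlt
  exact hsub (by simpa [dist_eq_norm] using hlt) ⟨hz, hz1⟩

/-- A finite subgroup that contains a set of translates covering the group meets the translated
neighbourhood in positive proportion. -/
theorem card_le_card_mul_card_filter {Q : Type*} [AddCommGroup Q]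
    {F : AddSubgroup Q} [Fintype F] {s : Finset Q} {U : Set Q}
    [DecidablePred fun v : F => (v : Q) ∈ U]
    (hsF : ∀ a ∈ s, a ∈ F) (hs : ∀ x, ∃ a ∈ s, x - a ∈ U) :
    Fintype.card F ≤ s.card * (Finset.univ.filter fun v : F => (v : Q) ∈ U).card := by
  classical
  choose a has haU using hs
  rw [← Finset.card_product, ← Finset.card_univ]
  refine Finset.card_le_card_of_injOn
    (fun x : F => ((a x : Q), x - (⟨a x, hsF _ (has _)⟩ : F))) ?_ ?_
  · intro x _
    simp [has, haU]
  · intro x _ y _ hxy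
    simp only [Prod.mk.injEq] at hxy
    obtain ⟨h1, h2⟩ := hxy
    have h3 := congrArg (Subtype.val) h2
    simp only [AddSubgroup.coe_sub, h1] at h3
    exact Subtype.ext (sub_left_injective h3)

/-- A nonnegative function on a finite subgroup that is at least `c` near `0` has sum at least `c`
times a positive proportion of the order. -/
theorem card_mul_le_card_mul_sum {Q : Type*} [AddCommGroup Q] {F : AddSubgroup Q} [Fintype F]
    {s : Finset Q} {U : Set Q} (hsF : ∀ a ∈ s, a ∈ F) (hs : ∀ x, ∃ a ∈ s, x - a ∈ U)
    {φ : F → ℝ} (hφ : ∀ v, 0 ≤ φ v) {c : ℝ} (hc : 0 ≤ c) (hcφ : ∀ v : F, (v : Q) ∈ U → c ≤ φ v) :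
    (Fintype.card F : ℝ) * c ≤ s.card * ∑ v, φ v := by
  classical
  have hcard : (Fintype.card F : ℝ) ≤
      s.card * ((Finset.univ.filter fun v : F => (v : Q) ∈ U).card : ℝ) := by
    exact_mod_cast card_le_card_mul_card_filter hsF hs
  refine (mul_le_mul_of_nonneg_right hcard hc).trans ?_
  rw [mul_assoc]
  gcongr
  rw [← nsmul_eq_mul, ← Finset.sum_const]
  exact (Finset.sum_le_sum fun v hv => hcφ v (Finset.mem_filter.1 hv).2).trans
    (Finset.sum_le_sum_of_subset_of_nonneg (Finset.filter_subset _ _) fun v _ _ => hφ v)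

theorem finite_closure_of_nsmul_eq_zero {Q : Type*} [AddCommGroup Q]
    {d : ℕ} (hd : 0 < d) (htors : ∀ x : Q, d • x = 0)
    (s : Finset Q) : Finite (AddSubgroup.closure (s : Set Q)) := by
  have : AddGroup.FG (AddSubgroup.closure (s : Set Q)) := AddGroup.closure_finset_fg s
  refine AddCommGroup.finite_of_fg_isAddTorsion _ ?_
  intro x
  refine isOfFinAddOrder_iff_nsmul_eq_zero.2 ⟨d, hd, Subtype.ext (by simpa using htors x)⟩

section ConnectedTorsion

variable {Q : Type*} [AddCommGroup Q] [TopologicalSpace Q] [IsTopologicalAddGroup Q]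

/-- In a compact group finitely many translates of a neighbourhood of `0` cover. -/
theorem exists_finset_forall_exists_sub_mem [CompactSpace Q] {U : Set Q} (hU : U ∈ 𝓝 0) :
    ∃ s : Finset Q, ∀ x, ∃ a ∈ s, x - a ∈ U := by
  have h : ∀ a ∈ (Set.univ : Set Q), {x | x - a ∈ U} ∈ 𝓝 a := fun a _ =>
    (by fun_prop : Continuous fun x : Q => x - a).continuousAt.preimage_mem_nhds (by simpa using hU)
  obtain ⟨s, -, hs⟩ := isCompact_univ.elim_nhds_subcover (fun a => {x | x - a ∈ U}) h
  exact ⟨s, fun x => by simpa using hs (Set.mem_univ x)⟩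

/-- Uniform continuity of a real function on a compact group, in terms of translations. -/
theorem eventually_forall_abs_sub_le [CompactSpace Q] {f : Q → ℝ} (hf : Continuous f) {ε : ℝ}
    (hε : 0 < ε) : ∀ᶠ u in 𝓝 (0 : Q), ∀ x, |f (x + u) - f x| ≤ ε := by
  have : ∀ᶠ u in 𝓝 (0 : Q), ∀ x ∈ (Set.univ : Set Q), |f (x + u) - f x| ≤ ε := by
    refine isCompact_univ.eventually_forall_of_forall_eventually fun x _ => ?_
    have hc : Continuous fun z : Q × Q => |f (z.2 + z.1) - f z.2| := by fun_prop
    have := hc.tendsto (0, x)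
    simp only [add_zero, sub_self, abs_zero] at this
    exact this.eventually (ge_mem_nhds hε)
  simpa using this

/-- A character of a subgroup of a connected group that is trivial near `0` is trivial, provided
the subgroup is sufficiently dense. -/
theorem addChar_eq_one_of_connected [ConnectedSpace Q] {F : AddSubgroup Q} {U V : Set Q}
    (hV : IsOpen V) (hV0 : (0 : Q) ∈ V) (hVU : ∀ v ∈ V, ∀ w ∈ V, v - w ∈ U)
    (hF : ∀ x, ∃ a ∈ F, x - a ∈ V) (χ : AddChar F ℂ) (hχ : ∀ u : F, (u : Q) ∈ U → χ u = 1)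
    (b : F) : χ b = 1 := by
  -- Points approximable by elements where `χ` is `1`, respectively is not `1`. Two approximants of
  -- one point differ by an element of `U`, so these open sets are disjoint; density makes them
  -- cover.
  set K : Set Q := {x | ∃ a : F, χ a = 1 ∧ x - a ∈ V} with hK
  set K' : Set Q := {x | ∃ a : F, χ a ≠ 1 ∧ x - a ∈ V} with hK'
  have hopen (p : F → Prop) : IsOpen {x : Q | ∃ a : F, p a ∧ x - a ∈ V} := by
    have : {x : Q | ∃ a : F, p a ∧ x - a ∈ V} = ⋃ a : F, ⋃ _ : p a, {x : Q | x - (a : Q) ∈ V} := by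
      ext; simp
    rw [this]
    exact isOpen_iUnion fun a => isOpen_iUnion fun _ => hV.preimage (by fun_prop)
  have hdisj {x : Q} (h1 : x ∈ K) (h2 : x ∈ K') : False := by
    obtain ⟨a, ha, hxa⟩ := h1
    obtain ⟨b, hb, hxb⟩ := h2
    have h3 := hχ (b - a) (by simpa using hVU _ hxa _ hxb)
    apply hb
    rw [← sub_add_cancel b a, AddChar.map_add_eq_mul, h3, ha, one_mul]
  have hcompl : K'ᶜ = K := by
    ext x
    refine ⟨fun hx => ?_, fun h1 h2 => hdisj h1 h2⟩
    obtain ⟨a, haF, hxa⟩ := hF x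
    by_cases h : χ ⟨a, haF⟩ = 1
    · exact ⟨⟨a, haF⟩, h, hxa⟩
    · exact absurd ⟨⟨a, haF⟩, h, hxa⟩ hx
  have hclopen : IsClopen K := ⟨hcompl ▸ (hopen _).isClosed_compl, hopen _⟩
  have huniv : K = Set.univ := hclopen.eq_univ ⟨0, 0, by simp, by simpa⟩
  by_contra hb
  exact hdisj (x := (b : Q)) (huniv ▸ Set.mem_univ _) ⟨b, hb, by simpa⟩

/-- The nontrivial Fourier coefficients, on a sufficiently dense finite subgroup of a connected
group of bounded exponent, of a function with small translation differences near `0`. -/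
theorem norm_sum_mul_addChar_le [ConnectedSpace Q] {d : ℕ} (htors : ∀ x : Q, d • x = 0) {f : Q → ℝ}
    {κ η : ℝ} (hκ0 : 0 < κ) (hη0 : 0 < η) (hκ : ∀ z : ℂ, z ^ d = 1 → z ≠ 1 → κ ≤ ‖z - 1‖)
    {V : Set Q} (hV : IsOpen V) (hV0 : (0 : Q) ∈ V)
    (hVU : ∀ v ∈ V, ∀ w ∈ V, v - w ∈ {u | ∀ x, |f (x + u) - f x| ≤ η * κ})
    {F : AddSubgroup Q} [Fintype F] (hF : ∀ x, ∃ a ∈ F, x - a ∈ V) (hsum : ∑ w : F, f w = 0)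
    (χ : AddChar F ℂ) : ‖∑ w : F, ((f w : ℝ) : ℂ) * χ w‖ ≤ η * Fintype.card F := by
  -- Translating by `u` multiplies the coefficient by `χ (-u)`; if `χ u ≠ 1`, a small translation
  -- difference forces a small coefficient.
  have hshift (u : F) : (χ (-u) - 1) * ∑ w : F, ((f w : ℝ) : ℂ) * χ w
      = ∑ w : F, ((f ((w + u : F) : Q) - f w : ℝ) : ℂ) * χ w := by
    have : χ (-u) * ∑ w : F, ((f w : ℝ) : ℂ) * χ w
        = ∑ w : F, ((f ((w + u : F) : Q) : ℝ) : ℂ) * χ w := by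
      rw [Finset.mul_sum]
      refine (Fintype.sum_equiv (Equiv.addRight u) _ _ fun w => ?_).symm
      simp only [Equiv.coe_addRight, AddChar.map_add_eq_mul]
      have h1 : χ (-u) * χ u = 1 := by rw [← AddChar.map_add_eq_mul]; simp
      linear_combination (-((f ((w + u : F) : Q) : ℝ) : ℂ) * χ w) * h1
    rw [sub_mul, this, one_mul, ← Finset.sum_sub_distrib]
    refine Finset.sum_congr rfl fun w _ => ?_
    push_cast; ring
  by_cases hχ : ∀ u : F, (∀ x, |f (x + u) - f x| ≤ η * κ) → χ u = 1
  · have hχ1 : ∀ b, χ b = 1 := addChar_eq_one_of_connected hV hV0 hVU hF χ hχ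
    simp only [hχ1, mul_one, ← Complex.ofReal_sum, hsum]
    simp only [Complex.ofReal_zero, norm_zero]
    positivity
  · push Not at hχ
    obtain ⟨u, hu, hχu⟩ := hχ
    have h1 : κ ≤ ‖χ (-u) - 1‖ := by
      refine hκ _ ?_ ?_
      · rw [← AddChar.map_nsmul_eq_pow]
        have : d • (-u) = 0 := Subtype.ext (by simpa using htors u)
        rw [this, AddChar.map_zero_eq_one]
      · rw [AddChar.map_neg_eq_inv]
        simpa using hχu
    have h2 : ‖∑ w : F, ((f ((w + u : F) : Q) - f w : ℝ) : ℂ) * χ w‖ ≤ κ * (η * Fintype.card F) := by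
      calc _ ≤ ∑ w : F, η * κ := by
            refine norm_sum_le_of_le _ fun w _ => ?_
            rw [norm_mul, χ.norm_apply, mul_one, Complex.norm_real]
            exact hu w
        _ = κ * (η * Fintype.card F) := by simp; ring
    rw [← hshift, norm_mul] at h2
    refine le_of_mul_le_mul_left (le_trans ?_ h2) hκ0
    gcongr

/-- A lower bound for the Fourier coefficients of a continuous function on dense finite
subgroups. -/
theorem sq_le_of_norm_sum_mul_addChar_le {Q : Type*} [AddCommGroup Q] {f : Q → ℝ} {B δ η : ℝ}
    (hB : ∀ x, |f x| ≤ B) (hB1 : 1 ≤ B) {s₁ s₂ : Finset Q} (hs₁0 : (0 : ℝ) < s₁.card)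
    (hδ0 : 0 < δ) (hδ : δ * s₁.card = 1 / 4)
    (hs₁ : ∀ x, ∃ a ∈ s₁, x - a ∈ {x | 1 / 2 < f x})
    (hs₂ : ∀ x, ∃ a ∈ s₂, x - a ∈ {u | ∀ x, |f (x + u) - f x| ≤ δ / (2 * B)})
    {F : AddSubgroup Q} [Fintype F] (hs₁F : ∀ a ∈ s₁, a ∈ F) (hs₂F : ∀ a ∈ s₂, a ∈ F)
    (hfour : ∀ χ : AddChar F ℂ, ‖∑ w : F, ((f w : ℝ) : ℂ) * χ w‖ ≤ η * Fintype.card F) :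
    (δ / 2) ^ 2 ≤ η ^ 2 * B ^ 2 * s₂.card := by
  have hmain := sum_sq_autocorrelation_le (fun w : F => f w) η hfour
  set N : ℝ := (Fintype.card F : ℝ) with hN
  have hN0 : 0 < N := by simp [hN, Fintype.card_pos]
  have hsq_le : ∑ w : F, f w ^ 2 ≤ N * B ^ 2 := by
    calc _ ≤ ∑ w : F, B ^ 2 := Finset.sum_le_sum fun w _ => sq_le_sq' (by
            linarith [neg_abs_le (f w), hB w]) ((le_abs_self _).trans (hB w))
      _ = _ := by simp [hN]
  have hle_sq : N * δ ≤ ∑ w : F, f w ^ 2 := by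
    have h1 := card_mul_le_card_mul_sum (F := F) (φ := fun w => f w ^ 2) (c := 1 / 4)
      hs₁F hs₁ (fun w => sq_nonneg _) (by norm_num) (fun w hw => by
        have : 1 / 2 < f w := hw
        nlinarith)
    have h2 : (Fintype.card F : ℝ) * (1 / 4) = s₁.card * (N * δ) := by
      have : (s₁.card : ℝ) * δ = 1 / 4 := by rw [mul_comm]; exact hδ
      rw [← this]; ring
    rw [h2] at h1
    exact le_of_mul_le_mul_left h1 hs₁0
  -- For an almost-period `v`, the autocorrelation stays close to its value at `0`, which is at
  -- least `N * δ`.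
  have hcorr (v : F) (hv : ∀ x, |f (x + v) - f x| ≤ δ / (2 * B)) :
      N * (δ / 2) ≤ ∑ w : F, f ((w + v : F) : Q) * f w := by
    have : ∑ w : F, (f w ^ 2 - δ / 2) ≤ ∑ w : F, f ((w + v : F) : Q) * f w := by
      refine Finset.sum_le_sum fun w _ => ?_
      have h1 : |(f w - f ((w + v : F) : Q)) * f w| ≤ δ / (2 * B) * B := by
        rw [abs_mul, abs_sub_comm]
        exact mul_le_mul (hv w) (hB w) (abs_nonneg _) (by positivity)
      have h2 : δ / (2 * B) * B = δ / 2 := by field_simp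
      nlinarith [le_abs_self ((f w - f ((w + v : F) : Q)) * f w)]
    refine le_trans ?_ this
    rw [Finset.sum_sub_distrib]
    simp only [Finset.sum_const, Finset.card_univ, nsmul_eq_mul, ← hN]
    linarith
  have hlow : N * (N * (δ / 2)) ^ 2
      ≤ s₂.card * ∑ v : F, (∑ w : F, f ((w + v : F) : Q) * f w) ^ 2 :=
    card_mul_le_card_mul_sum (F := F) hs₂F hs₂
      (fun w => sq_nonneg _) (by positivity) (fun v hv =>
        pow_le_pow_left₀ (by positivity) (hcorr v hv) 2)
  have hfinal : N * (N * (δ / 2)) ^ 2 ≤ s₂.card * (η ^ 2 * N ^ 2 * (N * B ^ 2)) := by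
    refine hlow.trans ?_
    gcongr
    exact hmain.trans (by gcongr)
  have h3 : N ^ 3 * (δ / 2) ^ 2 ≤ N ^ 3 * (η ^ 2 * B ^ 2 * s₂.card) := by
    calc _ = N * (N * (δ / 2)) ^ 2 := by ring
      _ ≤ _ := hfinal
      _ = _ := by ring
  exact le_of_mul_le_mul_left h3 (by positivity)

/-- A compact connected group of bounded exponent is trivial. -/
theorem subsingleton_of_nsmul_eq_zero [CompactSpace Q] [ConnectedSpace Q] [T2Space Q] {d : ℕ}
    (hd : 0 < d) (htors : ∀ x : Q, d • x = 0) : Subsingleton Q := by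
  classical
  by_contra hns
  rw [not_subsingleton_iff_nontrivial] at hns
  obtain ⟨a, ha⟩ := exists_ne (0 : Q)
  obtain ⟨g, hg0, hga, -⟩ := exists_continuous_zero_one_of_isClosed
    (isClosed_singleton (x := (0 : Q))) (isClosed_singleton (x := a)) (by simpa using ha.symm)
  -- A translation difference sums to zero over every finite subgroup containing `a`, which kills
  -- the trivial coefficient.
  set f : Q → ℝ := fun x => g (x + a) - g x with hf
  have hfc : Continuous f := by fun_prop
  have hf0 : f 0 = 1 := by
    have h1 := hg0 rfl
    have h2 := hga rfl
    simp only [Pi.zero_apply, Pi.one_apply] at h1 h2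
    simp [hf, h1, h2]
  obtain ⟨B, hB⟩ : ∃ B, ∀ x, |f x| ≤ B := by
    obtain ⟨B, hB⟩ := isCompact_univ.exists_bound_of_continuousOn hfc.continuousOn
    exact ⟨B, fun x => hB x trivial⟩
  have hB1 : 1 ≤ B := by simpa [hf0] using hB 0
  have hW : {x | 1 / 2 < f x} ∈ 𝓝 (0 : Q) :=
    hfc.continuousAt.preimage_mem_nhds (Ioi_mem_nhds (by rw [hf0]; norm_num))
  obtain ⟨s₁, hs₁⟩ := exists_finset_forall_exists_sub_mem hW
  have hs₁0 : (0 : ℝ) < s₁.card := by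
    obtain ⟨b, hb, -⟩ := hs₁ 0
    exact_mod_cast Finset.card_pos.2 ⟨b, hb⟩
  set δ : ℝ := 1 / (4 * s₁.card) with hδ
  have hδ0 : 0 < δ := by positivity
  obtain ⟨s₂, hs₂⟩ := exists_finset_forall_exists_sub_mem
    (eventually_forall_abs_sub_le hfc (ε := δ / (2 * B)) (by positivity))
  have hs₂0 : (0 : ℝ) < s₂.card := by
    obtain ⟨b, hb, -⟩ := hs₂ 0
    exact_mod_cast Finset.card_pos.2 ⟨b, hb⟩
  -- The choice of `η` uses only `B`, `δ` and `s₂`, so it precedes that of the finite subgroup.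
  obtain ⟨η, hη0, hη⟩ : ∃ η > 0, η ^ 2 * B ^ 2 < (δ / 2) ^ 2 / s₂.card := by
    refine ⟨δ / (4 * B * s₂.card), by positivity, ?_⟩
    have h1 : (1 : ℝ) ≤ s₂.card := by exact_mod_cast Nat.cast_pos.1 hs₂0
    have h2 : (δ / (4 * B * s₂.card)) ^ 2 * B ^ 2 = (δ / 2) ^ 2 / s₂.card * (1 / (4 * s₂.card)) := by
      field_simp; ring
    rw [h2]
    refine mul_lt_of_lt_one_right (by positivity) ?_
    rw [div_lt_one (by positivity)]
    linarith
  obtain ⟨κ, hκ0, hκ⟩ := exists_pos_le_norm_sub_one_of_pow_eq_one hd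
  have hU := eventually_forall_abs_sub_le hfc (ε := η * κ) (by positivity)
  obtain ⟨V', hV', hVU'⟩ := exists_nhds_half_neg hU
  obtain ⟨V, hVV', hV, hV0⟩ := mem_nhds_iff.1 hV'
  obtain ⟨s₃, hs₃⟩ := exists_finset_forall_exists_sub_mem (hV.mem_nhds hV0)
  -- The nets `s₁`, `s₂` give the lower bounds, `s₃` the density needed for connectedness, and `a`
  -- the zero sum.
  set F : AddSubgroup Q := AddSubgroup.closure ((s₁ ∪ s₂ ∪ s₃ ∪ {a} : Finset Q) : Set Q) with hF
  have hFfin : Finite F := finite_closure_of_nsmul_eq_zero hd htors _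
  have := Fintype.ofFinite F
  have hmem (x : Q) (hx : x ∈ s₁ ∪ s₂ ∪ s₃ ∪ {a}) : x ∈ F := AddSubgroup.subset_closure hx
  have haF : a ∈ F := hmem a (by simp)
  have hsum : ∑ w : F, f w = 0 := by
    simp only [hf, Finset.sum_sub_distrib, sub_eq_zero]
    exact Fintype.sum_equiv (Equiv.addRight (⟨a, haF⟩ : F)) _ _ fun w => by simp
  rw [lt_div_iff₀ hs₂0] at hη
  refine absurd (sq_le_of_norm_sum_mul_addChar_le (F := F) hB hB1 hs₁0 hδ0 ?_ hs₁ hs₂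
    (fun b hb => hmem b (by simp [hb])) (fun b hb => hmem b (by simp [hb]))
    (norm_sum_mul_addChar_le htors hκ0 hη0 hκ hV hV0
      (fun v hv w hw => hVU' v (hVV' hv) w (hVV' hw)) (fun x => ?_) hsum)) (not_le.2 hη)
  · rw [hδ]; field_simp
  · obtain ⟨b, hb, hxb⟩ := hs₃ x
    exact ⟨b, hmem b (by simp [hb]), hxb⟩

/-- A compact connected Hausdorff abelian group is divisible. -/
theorem zsmul_surjective_of_connected [CompactSpace Q] [ConnectedSpace Q] [T2Space Q] {d : ℤ}
    (hd : d ≠ 0) : Function.Surjective fun x : Q => d • x := by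
  let D : AddSubgroup Q := (zsmulAddGroupHom (α := Q) d).range
  have hDc : IsClosed (D : Set Q) := by
    have : (D : Set Q) = Set.range fun x : Q => d • x := rfl
    rw [this]
    exact (isCompact_range (continuous_zsmul d)).isClosed
  -- The quotient by the multiples of `d` is compact, connected and killed by `d`.
  have : Subsingleton (Q ⧸ D) := by
    have : ConnectedSpace (Q ⧸ D) := Quotient.instConnectedSpace
    refine subsingleton_of_nsmul_eq_zero (d := d.natAbs) (Int.natAbs_pos.2 hd) fun x => ?_
    induction x using QuotientAddGroup.induction_on with
    | H y =>
      rw [← QuotientAddGroup.mk_nsmul, QuotientAddGroup.eq_zero_iff]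
      rcases Int.natAbs_eq d with h | h
      · exact ⟨y, by simp only [zsmulAddGroupHom_apply]; conv_lhs => rw [h, natCast_zsmul]⟩
      · refine ⟨-y, ?_⟩
        simp only [zsmulAddGroupHom_apply]
        conv_lhs => rw [h, neg_smul_neg, natCast_zsmul]
  intro x
  have hx : x ∈ D := (QuotientAddGroup.eq_zero_iff x).1 (Subsingleton.elim _ _)
  exact hx

end ConnectedTorsion

/-! ### Borel–Cantelli under pairwise independence. -/

/-- The second Borel–Cantelli lemma for pairwise independent events. -/
theorem ae_frequently_mem_of_pairwise_indep {Ω : Type*} [MeasurableSpace Ω] {μ : Measure Ω}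
    [IsProbabilityMeasure μ] {A : ℕ → Set Ω} (hA : ∀ k, MeasurableSet (A k))
    (hind : Pairwise fun i j => μ (A i ∩ A j) = μ (A i) * μ (A j)) (hsum : ∑' k, μ (A k) = ∞) :
    ∀ᵐ ω ∂μ, ∃ᶠ k in atTop, ω ∈ A k := by
  set X : ℕ → Ω → ℝ := fun k => (A k).indicator 1 with hX
  have hXm (k : ℕ) : Measurable (X k) := measurable_one.indicator (hA k)
  have hX01 (k : ℕ) (ω : Ω) : 0 ≤ X k ω ∧ X k ω ≤ 1 := by
    by_cases h : ω ∈ A k <;> simp [hX, h]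
  have hL (k : ℕ) : MemLp (X k) 2 μ :=
    MemLp.of_bound (hXm k).aestronglyMeasurable 1 (Eventually.of_forall fun ω => by
      rw [Real.norm_eq_abs, abs_of_nonneg (hX01 k ω).1]; exact (hX01 k ω).2)
  have hmean (k : ℕ) : ∫ ω, X k ω ∂μ = μ.real (A k) := integral_indicator_one (hA k)
  have hvar (k : ℕ) : variance (X k) μ ≤ μ.real (A k) := by
    refine (variance_le_expectation_sq (hXm k).aestronglyMeasurable).trans ?_
    rw [← hmean]
    refine le_of_eq (integral_congr_ae (Eventually.of_forall fun ω => ?_))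
    by_cases h : ω ∈ A k <;> simp [hX, h]
  have hindep : Pairwise fun i j => IndepFun (X i) (X j) μ := fun i j hij => by
    have h : IndepSet (A i) (A j) μ := (indepSet_iff_measure_inter_eq_mul (hA i) (hA j) μ).2 (hind hij)
    have hle (k : ℕ) : MeasurableSpace.comap (X k) inferInstance ≤ .generateFrom {A k} := by
      have hAk : MeasurableSet[.generateFrom {A k}] (A k) :=
        MeasurableSpace.measurableSet_generateFrom (Set.mem_singleton _)
      have h1 : Measurable[.generateFrom {A k}] (X k) := by
        let _ := MeasurableSpace.generateFrom {A k}
        exact Measurable.indicator (f := fun _ => (1 : ℝ)) measurable_const hAk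
      exact h1.comap_le
    exact indep_of_indep_of_le_left (indep_of_indep_of_le_right h (hle j)) (hle i)
  set s : ℕ → ℝ := fun N => ∑ k ∈ Finset.range N, μ.real (A k) with hs
  have hs_top : Tendsto s atTop atTop := by
    refine (not_summable_iff_tendsto_nat_atTop_of_nonneg fun k => measureReal_nonneg).1 fun h => ?_
    have := ENNReal.ofReal_tsum_of_nonneg (fun k => measureReal_nonneg (μ := μ) (s := A k)) h
    refine ENNReal.ofReal_ne_top (this.trans ?_)
    rw [← hsum]
    exact tsum_congr fun k => ofReal_measureReal
  -- Chebyshev: the sum has mean `s N` and variance at most `s N`, and being at most `M` is a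
  -- deviation of at least `s N / 2`.
  have hdev {N : ℕ} {M : ℝ} (hN : 0 < s N) (hM : 2 * M ≤ s N) :
      μ {ω | ∑ k ∈ Finset.range N, X k ω ≤ M} ≤ ENNReal.ofReal (4 / s N) := by
    have hLs : MemLp (∑ k ∈ Finset.range N, X k) 2 μ := memLp_finsetSum' _ fun k _ => hL k
    have hE : ∫ ω, (∑ k ∈ Finset.range N, X k) ω ∂μ = s N := by
      simp only [Finset.sum_apply]
      rw [integral_finsetSum _ fun k _ => (hL k).integrable (by norm_num)]
      simp only [hmean, hs]
    have hV : variance (∑ k ∈ Finset.range N, X k) μ ≤ s N := by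
      rw [IndepFun.variance_sum (fun k _ => hL k) (fun i _ j _ hij => hindep hij)]
      exact Finset.sum_le_sum fun k _ => hvar k
    refine (measure_mono fun ω hω => ?_).trans
      ((meas_ge_le_variance_div_sq hLs (half_pos hN)).trans (ENNReal.ofReal_le_ofReal ?_))
    · simp only [Set.mem_ofPred_eq] at hω ⊢
      rw [hE, Finset.sum_apply, abs_sub_comm]
      exact le_trans (by linarith) (le_abs_self _)
    · rw [div_le_div_iff₀ (by positivity) hN]
      nlinarith
  have hnull (M : ℕ) : μ {ω | ∀ N, ∑ k ∈ Finset.range N, X k ω ≤ M} = 0 := by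
    have h4 : Tendsto (fun N => ENNReal.ofReal (4 / s N)) atTop (𝓝 0) := by
      rw [← ENNReal.ofReal_zero]
      exact (ENNReal.continuous_ofReal.tendsto 0).comp (hs_top.const_div_atTop 4)
    refine le_antisymm (ge_of_tendsto h4 ?_) zero_le
    filter_upwards [hs_top.eventually_gt_atTop 0, hs_top.eventually_ge_atTop (2 * M)] with N h1 h2
    exact (measure_mono fun ω (hω : ∀ N, _ ≤ (M : ℝ)) => hω N).trans (hdev h1 h2)
  have hall : ∀ᵐ ω ∂μ, ∀ M : ℕ, ¬ ∀ N, ∑ k ∈ Finset.range N, X k ω ≤ M :=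
    ae_all_iff.2 fun M => by simpa [ae_iff] using hnull M
  filter_upwards [hall] with ω hω
  by_contra hfin
  rw [not_frequently, eventually_atTop] at hfin
  obtain ⟨K, hK⟩ := hfin
  refine hω K fun N => ?_
  calc ∑ k ∈ Finset.range N, X k ω ≤ ∑ k ∈ Finset.range K, X k ω := by
        rcases le_total N K with h | h
        · exact Finset.sum_le_sum_of_subset_of_nonneg (Finset.range_mono h)
            fun k _ _ => (hX01 k ω).1
        · refine (Finset.sum_subset (Finset.range_mono h) fun k _ hk => ?_).ge
          have : ω ∉ A k := hK k (by simpa using hk)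
          simp [hX, this]
    _ ≤ ∑ k ∈ Finset.range K, 1 := Finset.sum_le_sum fun k _ => (hX01 k ω).2
    _ = K := by simp

/-! ### Random orbits, and measurability of addition. -/

section CompactGroup

variable {K : Type*} [AddCommGroup K] [TopologicalSpace K] [IsTopologicalAddGroup K]
  [MeasurableSpace K] [BorelSpace K]

/-- For almost every rotation `α` of a compact divisible group, almost every orbit along distinct
multiples of `α` visits infinitely often targets whose measures have infinite sum. -/
theorem ae_ae_frequently_add_zsmul_mem [CompactSpace K] (μ : Measure K) [μ.IsAddHaarMeasure]
    [IsProbabilityMeasure μ] (hdiv : ∀ d : ℤ, d ≠ 0 → Function.Surjective fun x : K => d • x)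
    {n : ℕ → ℤ} (hn : Function.Injective n) {E : ℕ → Set K} (hE : ∀ k, MeasurableSet (E k))
    (hE2 : ∀ k, MeasurableSet {p : K × K | p.1 + p.2 ∈ E k}) (hsum : ∑' k, μ (E k) = ∞) :
    ∀ᵐ α ∂μ, ∀ᵐ x ∂μ, ∃ᶠ k in atTop, x + n k • α ∈ E k := by
  have hmeas (d : ℤ) (k : ℕ) : MeasurableSet {p : K × K | p.1 + d • p.2 ∈ E k} := by
    have h : Measurable fun p : K × K => (p.1, d • p.2) :=
      measurable_fst.prodMk ((continuous_zsmul d).measurable.comp measurable_snd)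
    exact h (hE2 k)
  have hpres (d : ℤ) (hd : d ≠ 0) : MeasurePreserving (fun x : K => d • x) μ μ :=
    (zsmulAddGroupHom (α := K) d).measurePreserving (μ := μ) (continuous_zsmul d) (hdiv d hd) rfl
  have h1 (k : ℕ) : (μ.prod μ) {p : K × K | p.1 + n k • p.2 ∈ E k} = μ (E k) := by
    rw [Measure.prod_apply_symm (hmeas _ _)]
    have (α : K) : μ ((fun x => (x, α)) ⁻¹' {p : K × K | p.1 + n k • p.2 ∈ E k}) = μ (E k) :=
      measure_preimage_add_right μ (n k • α) (E k)
    simp_rw [this]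
    simp
  have h2 (i j : ℕ) (hij : i ≠ j) : (μ.prod μ)
      ({p : K × K | p.1 + n i • p.2 ∈ E i} ∩ {p : K × K | p.1 + n j • p.2 ∈ E j})
        = μ (E i) * μ (E j) := by
    -- For fixed `α`, the shift of `x` by `n i • α` turns the intersection into `T`. For fixed `x`,
    -- only the multiple `(n j - n i) • α` then varies, and it is Haar distributed.
    set T : Set (K × K) := {p | p.1 ∈ E i ∧ p.1 + (n j - n i) • p.2 ∈ E j} with hT
    have hTm : MeasurableSet T := (measurable_fst (hE i)).inter (hmeas _ _)
    have hd : n j - n i ≠ 0 := sub_ne_zero.2 fun h => hij (hn h.symm)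
    calc _ = (μ.prod μ) T := by
          rw [Measure.prod_apply_symm ((hmeas _ _).inter (hmeas _ _)), Measure.prod_apply_symm hTm]
          refine lintegral_congr fun α => ?_
          rw [← measure_preimage_add_right μ (n i • α) ((fun x => (x, α)) ⁻¹' T)]
          congr 1
          ext x
          simp [hT, sub_smul]
      _ = ∫⁻ x, (E i).indicator (fun _ => μ (E j)) x ∂μ := by
          rw [Measure.prod_apply hTm]
          refine lintegral_congr fun x => ?_
          by_cases hx : x ∈ E i
          · have : Prod.mk x ⁻¹' T = (fun α => (n j - n i) • α) ⁻¹' ((fun y => x + y) ⁻¹' E j) := by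
              ext α; simp [hT, hx]
            rw [this, (hpres _ hd).measure_preimage
              (measurable_const_add x (hE j)).nullMeasurableSet, measure_preimage_add]
            simp [hx]
          · have : Prod.mk x ⁻¹' T = ∅ := by ext α; simp [hT, hx]
            simp [this, hx]
      _ = _ := by rw [lintegral_indicator_const (hE i), mul_comm]
  have hBC : ∀ᵐ p ∂μ.prod μ, ∃ᶠ k in atTop, p ∈ {p : K × K | p.1 + n k • p.2 ∈ E k} :=
    ae_frequently_mem_of_pairwise_indep (fun k => hmeas _ _)
      (fun i j hij => by simpa only [h1] using h2 i j hij) (by simpa only [h1] using hsum)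
  have hswap := (Measure.measurePreserving_swap (μ := μ) (ν := μ)).quasiMeasurePreserving.ae hBC
  exact Measure.ae_ae_of_ae_prod hswap

/-- A continuous function on a compact group, composed with addition, is measurable for the product
of the Borel `σ`-algebras, even without second countability. -/
theorem measurable_comp_add_of_continuous [CompactSpace K] {φ : K → ℝ} (hφ : Continuous φ) :
    Measurable fun p : K × K => φ (p.1 + p.2) := by
  have hex (j : ℕ) : ∃ U : Set K, (IsOpen U ∧ ∀ u ∈ U, ∀ x, |φ (x + u) - φ x| ≤ 1 / (j + 1 : ℝ)) ∧
      ∃ s : Finset K, ∀ x, ∃ a ∈ s, x - a ∈ U := by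
    obtain ⟨U, hU, hUo, hU0⟩ := mem_nhds_iff.1
      (eventually_forall_abs_sub_le hφ (ε := 1 / (j + 1 : ℝ)) (by positivity))
    exact ⟨U, ⟨hUo, hU⟩, exists_finset_forall_exists_sub_mem (hUo.mem_nhds hU0)⟩
  choose U hU s hs using hex
  refine measurable_of_Ioi fun c => ?_
  -- Replacing `x` by a nearby net point `a` costs at most `1 / (j + 1)`, so the preimage is a
  -- countable union of measurable rectangles.
  have : (fun p : K × K => φ (p.1 + p.2)) ⁻¹' Set.Ioi c = ⋃ j : ℕ, ⋃ a ∈ s j,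
      {x | x - a ∈ U j} ×ˢ {y | c + 1 / (j + 1 : ℝ) < φ (a + y)} := by
    have hclose {j : ℕ} {x a y : K} (h : x - a ∈ U j) :
        |φ (x + y) - φ (a + y)| ≤ 1 / (j + 1 : ℝ) := by
      have := (hU j).2 _ h (a + y)
      rwa [show a + y + (x - a) = x + y by abel] at this
    ext ⟨x, y⟩
    simp only [Set.mem_preimage, Set.mem_Ioi, Set.mem_iUnion, Set.mem_prod, Set.mem_ofPred_eq,
      exists_prop]
    constructor
    · intro h
      obtain ⟨j, hj⟩ := exists_nat_one_div_lt (half_pos (sub_pos.2 h))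
      obtain ⟨a, ha, hxa⟩ := hs j x
      exact ⟨j, a, ha, hxa, by linarith [(abs_le.1 (hclose (y := y) hxa)).2]⟩
    · rintro ⟨j, a, -, hxa, h⟩
      linarith [(abs_le.1 (hclose (y := y) hxa)).1]
  rw [this]
  refine MeasurableSet.iUnion fun j => Finset.measurableSet_biUnion _ fun a _ => ?_
  refine MeasurableSet.prod ?_ ?_
  · exact ((hU j).1.preimage (by fun_prop : Continuous fun x : K => x - a)).measurableSet
  · exact (isOpen_lt continuous_const (by fun_prop : Continuous fun y => φ (a + y))).measurableSet

/-- Every almost everywhere measurable function on a compact group agrees almost everywhere with a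
function whose composition with addition is measurable for the product `σ`-algebra. -/
theorem exists_ae_eq_measurable_comp_add [CompactSpace K] [T2Space K] (m : Measure K)
    [IsFiniteMeasure m] [m.Regular] {f : K → ℝ} (hf : AEMeasurable f m) :
    ∃ g : K → ℝ, f =ᵐ[m] g ∧ Measurable g ∧ Measurable fun p : K × K => g (p.1 + p.2) := by
  -- The arctangent makes the function bounded, hence an `L¹` limit of continuous functions; the
  -- tangent undoes it at the end.
  set h : K → ℝ := fun x => Real.arctan (f x) with hh
  have hL : MemLp h 1 m := by
    refine MemLp.of_bound (Real.measurable_arctan.comp_aemeasurable hf).aestronglyMeasurable (Real.pi / 2)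
      (Eventually.of_forall fun x => ?_)
    exact abs_le.2 ⟨(Real.neg_pi_div_two_lt_arctan _).le, (Real.arctan_lt_pi_div_two _).le⟩
  have hex (j : ℕ) := hL.exists_boundedContinuous_eLpNorm_sub_le ENNReal.one_ne_top
    (ε := (j + 1 : ℝ≥0∞)⁻¹) (by simp)
  choose φ hφ hφL using hex
  have htend : Tendsto (fun j => eLpNorm ((φ j : K → ℝ) - h) 1 m) atTop (𝓝 0) := by
    have h0 : Tendsto (fun j : ℕ => (j + 1 : ℝ≥0∞)⁻¹) atTop (𝓝 0) := by
      have := (tendsto_add_atTop_iff_nat 1).2 ENNReal.tendsto_inv_nat_nhds_zero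
      simpa using this
    refine tendsto_of_tendsto_of_tendsto_of_le_of_le tendsto_const_nhds h0 (fun _ => zero_le) ?_
    intro j
    simp only
    rw [eLpNorm_sub_comm]
    exact hφ j
  obtain ⟨ns, -, hns⟩ := (tendstoInMeasure_of_tendsto_eLpNorm one_ne_zero
    (fun j => (hφL j).aestronglyMeasurable) hL.aestronglyMeasurable htend).exists_seq_tendsto_ae
  have htan : Measurable Real.tan := by
    have : Real.tan = fun x => Real.sin x / Real.cos x := funext Real.tan_eq_sin_div_cos
    rw [this]
    exact Real.measurable_sin.div Real.measurable_cos
  -- The limit is formed at every point, with a default value where it fails to exist, so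
  -- measurability passes from the `φ (ns i)` to `g` and to its composition with addition.
  refine ⟨fun x => Real.tan (limUnder atTop fun i => φ (ns i) x), ?_, ?_, ?_⟩
  · filter_upwards [hns] with x hx
    rw [hx.limUnder_eq, hh]
    exact (Real.tan_arctan _).symm
  · exact htan.comp (StronglyMeasurable.limUnder (l := atTop) fun i =>
      (φ (ns i)).continuous.measurable.stronglyMeasurable).measurable
  · exact htan.comp (StronglyMeasurable.limUnder (l := atTop) fun i =>
      (measurable_comp_add_of_continuous (φ (ns i)).continuous).stronglyMeasurable).measurable

end CompactGroup

/-! ### Divergent sums of level sets. -/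

/-- The level sets of a nonintegrable function have divergent total measure. -/
theorem tsum_measure_lt_abs_eq_top {Ω : Type*} [MeasurableSpace Ω] {m : Measure Ω} {g : Ω → ℝ}
    (hg : Measurable g) (hint : ¬ Integrable g m) {M : ℝ} (hM : 0 < M) :
    ∑' k : ℕ, m {x | M * k < |g x|} = ∞ := by
  by_contra hne
  refine hint ⟨hg.aestronglyMeasurable, ?_⟩
  have hmeas (k : ℕ) : MeasurableSet {x | M * k < |g x|} := measurableSet_lt measurable_const hg.abs
  have hpt (x : Ω) : ‖g x‖ₑ ≤
      ∑' k : ℕ, {x | M * k < |g x|}.indicator (fun _ => ENNReal.ofReal M) x := by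
    -- Exactly `⌈|g x| / M⌉₊` indices satisfy `M * k < |g x|`, counting `k = 0`.
    refine le_trans ?_ (ENNReal.sum_le_tsum (Finset.range ⌈|g x| / M⌉₊))
    have : ∀ k ∈ Finset.range ⌈|g x| / M⌉₊,
        {x | M * k < |g x|}.indicator (fun _ => ENNReal.ofReal M) x = ENNReal.ofReal M := by
      intro k hk
      rw [Finset.mem_range, Nat.lt_ceil, lt_div_iff₀' hM] at hk
      exact Set.indicator_of_mem (by exact hk) _
    rw [Finset.sum_congr rfl this, Finset.sum_const, Finset.card_range, Real.enorm_eq_ofReal_abs,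
      nsmul_eq_mul, ← ENNReal.ofReal_natCast, ← ENNReal.ofReal_mul (by positivity)]
    exact ENNReal.ofReal_le_ofReal ((div_le_iff₀ hM).1 (Nat.le_ceil _))
  calc ∫⁻ x, ‖g x‖ₑ ∂m
      ≤ ∫⁻ x, ∑' k : ℕ, {x | M * k < |g x|}.indicator (fun _ => ENNReal.ofReal M) x ∂m :=
        lintegral_mono hpt
    _ = ENNReal.ofReal M * ∑' k : ℕ, m {x | M * k < |g x|} := by
        rw [lintegral_tsum fun k => (measurable_const.indicator (hmeas k)).aemeasurable,
          ← ENNReal.tsum_mul_left]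
        exact tsum_congr fun k => lintegral_indicator_const (hmeas k) _
    _ < ∞ := ENNReal.mul_lt_top ENNReal.ofReal_lt_top (lt_top_iff_ne_top.2 hne)

/-- If a finite sum of decreasing sequences is constantly infinite, then so is one of the
summands. -/
theorem exists_forall_eq_top_of_antitone {ι : Type*} [Fintype ι] {u : ℕ → ι → ℝ≥0∞}
    (hanti : ∀ i, Antitone fun M => u M i) (hsum : ∀ M, ∑ i, u M i = ∞) :
    ∃ i, ∀ M, u M i = ∞ := by
  have hex (M : ℕ) : ∃ i, u M i = ∞ := by
    simpa using ENNReal.sum_eq_top.1 (hsum M)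
  choose i hi using hex
  obtain ⟨j, hj⟩ := Finite.exists_infinite_fiber i
  refine ⟨j, fun M => ?_⟩
  obtain ⟨M', hM', hlt⟩ := (Set.infinite_coe_iff.1 hj).exists_gt M
  have h1 : u M' j = ∞ := by
    have : i M' = j := hM'
    rw [← this]; exact hi M'
  exact top_le_iff.1 (h1 ▸ hanti j hlt.le)

/-! ### Reduction to the cosets of an open subgroup. -/

namespace NonconvRotation

theorem exists_quotient_neg_out_add_mem {G : Type*} [AddCommGroup G] (H : AddSubgroup G) (y : G) :
    ∃ q : G ⧸ H, -q.out + y ∈ H :=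
  ⟨y, QuotientAddGroup.eq.1 (Quotient.out_eq _)⟩

section CosetDecomposition

variable {G : Type*} [AddCommGroup G] [TopologicalSpace G] [IsTopologicalAddGroup G]
  [MeasurableSpace G] [BorelSpace G] (m : Measure G) [m.IsAddHaarMeasure]

/-- The measure of a set is at most the sum of the measures of its pieces in the cosets of an open
subgroup. -/
theorem measure_le_sum_comap (H : AddSubgroup G) (hH : IsOpen (H : Set G)) [Fintype (G ⧸ H)]
    (A : Set G) :
    m A ≤ ∑ q : G ⧸ H, m.comap ((↑) : H → G) {h | q.out + (h : G) ∈ A} := by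
  have hcov : A ⊆ ⋃ q ∈ (Finset.univ : Finset (G ⧸ H)), A ∩ {y | -q.out + y ∈ H} := fun y hy => by
    obtain ⟨q, hq⟩ := exists_quotient_neg_out_add_mem H y
    simp only [Set.mem_iUnion]
    exact ⟨q, Finset.mem_univ _, hy, hq⟩
  refine (measure_mono hcov).trans ((measure_biUnion_finset_le _ _).trans
    (Finset.sum_le_sum fun q _ => ?_))
  have hemb : MeasurableEmbedding ((↑) : H → G) := .subtype_coe hH.measurableSet
  rw [hemb.comap_apply,
    ← measure_preimage_add m q.out]
  refine measure_mono ?_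
  rintro y ⟨hy, hyH⟩
  simp only [Set.mem_ofPred_eq, neg_add_cancel_left] at hyH
  exact ⟨⟨y, hyH⟩, hy, rfl⟩

/-- In each coset of an open divisible subgroup of finite index, almost every rotation fails to have
the growth property when the function is not integrable. -/
theorem ae_comap_add_notMem_rotationSetBdd [IsProbabilityMeasure m] (H : AddSubgroup G)
    (hH : IsOpen (H : Set G)) [CompactSpace H] [Finite (G ⧸ H)]
    (hdiv : ∀ d : ℤ, d ≠ 0 → Function.Surjective fun x : H => d • x)
    {n : ℕ → ℤ} (hn : Function.Injective n) {g : G → ℝ} (hg : Measurable g)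
    (hg2 : Measurable fun p : G × G => g (p.1 + p.2)) (hint : ¬ Integrable g m) (a : G) :
    ∀ᵐ h : H ∂m.comap ((↑) : H → G), a + (h : G) ∉ rotationSetBdd m n g := by
  have := Fintype.ofFinite (G ⧸ H)
  set ν := m.comap ((↑) : H → G) with hν
  -- The shift by `n k • a` absorbs the fixed part of the rotation `a + α`, leaving `α` in `H`.
  set E : ℕ → G → ℕ → Set H := fun M x k => {h | (M + 1 : ℝ) * k < |g (x + h + n k • a)|} with hE
  -- By pigeonhole, one coset serves all thresholds `M`.
  obtain ⟨q, hq⟩ : ∃ q : G ⧸ H, ∀ M, ∑' k, ν (E M q.out k) = ∞ := by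
    refine exists_forall_eq_top_of_antitone
      (u := fun M (q : G ⧸ H) => ∑' k, ν (E M q.out k)) ?_ ?_
    · intro q M M' hMM'
      refine ENNReal.tsum_le_tsum fun k => measure_mono ?_
      rintro h (hh : (M' + 1 : ℝ) * k < _)
      refine lt_of_le_of_lt (?_ : (M + 1 : ℝ) * k ≤ (M' + 1 : ℝ) * k) hh
      gcongr
    · intro M
      rw [← tsum_fintype (L := .unconditional _), ENNReal.tsum_comm, ← top_le_iff,
        ← tsum_measure_lt_abs_eq_top hg hint (M := (M + 1 : ℝ)) (by positivity)]
      refine ENNReal.tsum_le_tsum fun k => ?_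
      rw [tsum_fintype, ← measure_preimage_add_right m (n k • a)]
      exact measure_le_sum_comap m H hH _
  have hemb : IsOpenEmbedding ((↑) : H → G) := hH.isOpenEmbedding_subtypeVal
  have hνH : ν.IsAddHaarMeasure := Measure.IsAddHaarMeasure.comap (mH := inferInstance) (f := H.subtype) m hemb
  have hνuniv : ν Set.univ ≠ ∞ := (isCompact_univ.measure_lt_top).ne
  have hνuniv0 : ν Set.univ ≠ 0 := (isOpen_univ.measure_pos ν ⟨0, trivial⟩).ne'
  have hcn0 : (ν Set.univ)⁻¹ ≠ 0 := ENNReal.inv_ne_zero.2 hνuniv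
  have hμH : ((ν Set.univ)⁻¹ • ν).IsAddHaarMeasure :=
    Measure.IsAddHaarMeasure.smul ν hcn0 (ENNReal.inv_ne_top.2 hνuniv0)
  have hμP : IsProbabilityMeasure ((ν Set.univ)⁻¹ • ν) :=
    ⟨by simp⟩
  have key (M : ℕ) : ∀ᵐ α : H ∂ν, ∀ᵐ h : H ∂ν, ∃ᶠ k in atTop, h + n k • α ∈ E M q.out k := by
    have := ae_ae_frequently_add_zsmul_mem ((ν Set.univ)⁻¹ • ν) hdiv hn (E := E M q.out)
      (fun k => ?_) (fun k => ?_) ?_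
    · simpa only [Measure.ae_ennreal_smul_measure_eq hcn0] using this
    · exact measurableSet_lt measurable_const (hg.comp
        (by fun_prop : Continuous fun h : H => q.out + (h : G) + n k • a).measurable).abs
    · have h1 : Measurable fun p : H × H => (q.out + (p.1 : G) + n k • a, (p.2 : G)) :=
        ((by fun_prop : Continuous fun h : H => q.out + (h : G) + n k • a).measurable.comp
          measurable_fst).prodMk (measurable_subtype_coe.comp measurable_snd)
      have h2 := measurableSet_lt (measurable_const (a := (M + 1 : ℝ) * k)) (hg2.comp h1).abs
      have h3 (p : H × H) : q.out + ((p.1 + p.2 : H) : G) + n k • a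
          = q.out + (p.1 : G) + n k • a + p.2 := by
        push_cast; abel
      simp only [hE, Set.mem_ofPred_eq, h3]
      exact h2
    · simp only [Measure.smul_apply, smul_eq_mul, ENNReal.tsum_mul_left, hq, ENNReal.mul_top hcn0]
  filter_upwards [ae_all_iff.2 key] with α hα hmem
  have hpull : ∀ᵐ h : H ∂ν, limsup (fun k : ℕ =>
      ((|g (q.out + (h : G) + n k • (a + (α : G)))| / (k : ℝ) : ℝ) : EReal)) atTop < ⊤ :=
    (ae_restrict_iff_subtype hH.measurableSet).1 (ae_restrict_of_ae
      ((measurePreserving_add_left m q.out).quasiMeasurePreserving.ae hmem))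
  have : (ae ν).NeBot := ae_neBot.2 fun h => hνuniv0 (by simp [h])
  -- One starting point suffices: there `|g|` is eventually below `c * k ≤ M * k`, yet exceeds `(M +
  -- 1) * k` infinitely often.
  obtain ⟨h, hlim, hfreq⟩ := (hpull.and (ae_all_iff.2 hα)).exists
  obtain ⟨c, hc, -⟩ := EReal.lt_iff_exists_real_btwn.1 hlim
  obtain ⟨M, hM⟩ := exists_nat_ge c
  have hev := (eventually_lt_of_limsup_lt hc).and (eventually_gt_atTop 0)
  obtain ⟨k, hk, hlt, hk0⟩ := ((hfreq M).and_eventually hev).exists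
  have hk' : (M + 1 : ℝ) * k < |g (q.out + ((h + n k • α : H) : G) + n k • a)| := hk
  rw [EReal.coe_lt_coe_iff, div_lt_iff₀ (by exact_mod_cast hk0)] at hlt
  have harg : q.out + ((h + n k • α : H) : G) + n k • a
      = q.out + (h : G) + n k • (a + (α : G)) := by
    push_cast
    rw [smul_add]
    abel
  rw [harg] at hk'
  have hk0' : (0 : ℝ) < k := by exact_mod_cast hk0
  nlinarith

/-- Almost every rotation fails to have the growth property when the function is not integrable. -/
theorem measure_rotationSetBdd_eq_zero [IsProbabilityMeasure m] (H : AddSubgroup G)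
    (hH : IsOpen (H : Set G)) [CompactSpace H] [Finite (G ⧸ H)]
    (hdiv : ∀ d : ℤ, d ≠ 0 → Function.Surjective fun x : H => d • x)
    {n : ℕ → ℤ} (hn : Function.Injective n) {g : G → ℝ} (hg : Measurable g)
    (hg2 : Measurable fun p : G × G => g (p.1 + p.2)) (hint : ¬ Integrable g m) :
    m (rotationSetBdd m n g) = 0 := by
  have hcoset (q : G ⧸ H) : ∀ᵐ α ∂m, -q.out + α ∈ H → α ∉ rotationSetBdd m n g := by
    have h1 := (ae_restrict_iff' (μ := m) hH.measurableSet).1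
      ((ae_restrict_iff_subtype (μ := m) hH.measurableSet
        (p := fun z => q.out + z ∉ rotationSetBdd m n g)).2
        (ae_comap_add_notMem_rotationSetBdd m H hH hdiv hn hg hg2 hint q.out))
    filter_upwards [(measurePreserving_add_left m (-q.out)).quasiMeasurePreserving.ae h1] with α hα
    simpa using hα
  have hall : ∀ᵐ α ∂m, α ∉ rotationSetBdd m n g := by
    filter_upwards [ae_all_iff.2 hcoset] with α hα
    obtain ⟨q, hq⟩ := exists_quotient_neg_out_add_mem H α
    exact hα q hq
  simpa [ae_iff] using hall

/-- Only countably many translates are involved and each preserves `m`, so the exceptional set stays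
null; this permits passing to a better representative of `f`. -/
theorem rotationSetBdd_subset_of_ae_eq (n : ℕ → ℤ) {f g : G → ℝ} (hfg : f =ᵐ[m] g) :
    rotationSetBdd m n f ⊆ rotationSetBdd m n g := by
  intro α hα
  have h : ∀ᵐ x ∂m, ∀ k, f (x + n k • α) = g (x + n k • α) := ae_all_iff.2 fun k =>
    (measurePreserving_add_right m (n k • α)).quasiMeasurePreserving.ae hfg
  have hα' : ∀ᵐ x ∂m, _ := hα
  filter_upwards [hα', h] with x hx hx'
  simpa only [hx'] using hx

end CosetDecomposition

/-! ### From averages to the growth condition. -/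

/-- The last term of a convergent sequence of averages is of smaller order than the index. -/
theorem tendsto_abs_div_of_tendsto_average {u : ℕ → ℝ} {c : ℝ}
    (h : Tendsto (fun N : ℕ => (1 / ((N : ℝ) + 1)) * ∑ k ∈ Finset.range (N + 1), u k)
      atTop (𝓝 c)) : Tendsto (fun k : ℕ => |u k| / (k : ℝ)) atTop (𝓝 0) := by
  rw [← tendsto_add_atTop_iff_nat 1]
  set A : ℕ → ℝ := fun N : ℕ => (1 / ((N : ℝ) + 1)) * ∑ k ∈ Finset.range (N + 1), u k with hA
  have hinv : Tendsto (fun N : ℕ => 1 / ((N : ℝ) + 1)) atTop (𝓝 0) :=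
    tendsto_one_div_add_atTop_nhds_zero_nat
  -- The expression inside the absolute value equals `u (N + 1) / (N + 1)`, by cancelling the common
  -- partial sum of consecutive averages.
  have hlim : Tendsto (fun N : ℕ => |(1 + 1 / ((N : ℝ) + 1)) * A (N + 1) - A N|) atTop (𝓝 0) := by
    have := (((tendsto_const_nhds (x := (1 : ℝ))).add hinv).mul
      ((tendsto_add_atTop_iff_nat 1).2 h)).sub h
    simpa using this.abs
  refine hlim.congr fun N => ?_
  have hN : ((N : ℝ) + 1) ≠ 0 := by positivity
  have hN2 : ((N : ℝ) + 1 + 1) ≠ 0 := by positivity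
  have : (1 + 1 / ((N : ℝ) + 1)) * A (N + 1) - A N = u (N + 1) / ((N : ℝ) + 1) := by
    simp only [hA]
    rw [Finset.sum_range_succ _ (N + 1)]
    push_cast
    field_simp
    ring
  rw [this, abs_div, abs_of_pos (by positivity : (0 : ℝ) < (N : ℝ) + 1)]
  push_cast
  rfl

theorem rotationSet_subset_rotationSetBdd {G : Type*} [AddCommGroup G] [MeasurableSpace G]
    (m : Measure G) (n : ℕ → ℤ) (f : G → ℝ) : rotationSet m n f ⊆ rotationSetBdd m n f := by
  intro α hα
  have hα' : ∀ᵐ x ∂m, ∃ c : ℝ, Tendsto (fun N : ℕ => rotAverage n f α N x) atTop (𝓝 c) := hα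
  change ∀ᵐ x ∂m, _
  filter_upwards [hα'] with x ⟨c, hc⟩
  have h := tendsto_abs_div_of_tendsto_average (u := fun k => f (x + n k • α)) hc
  have h' := (continuous_coe_real_ereal.tendsto 0).comp h
  have h2 : limsup (fun k : ℕ => ((|f (x + n k • α)| / (k : ℝ) : ℝ) : EReal)) atTop = (0 : ℝ) :=
    h'.limsup_eq
  rw [h2]
  exact EReal.coe_lt_top 0

end NonconvRotation

/-! ### The main theorem. -/

/-- `m` is the normalized Haar measure: the regular translation-invariant Borel probability
measure. `AEMeasurable f m` is measurability of `f` with respect to the completion of `m`. -/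
theorem theorem3p1 {G : Type*} [AddCommGroup G] [TopologicalSpace G] [IsTopologicalAddGroup G]
    [CompactSpace G] [T2Space G] [LocallyConnectedSpace G] [MeasurableSpace G] [BorelSpace G]
    (m : Measure G) [m.IsAddHaarMeasure] [m.Regular] [IsProbabilityMeasure m]
    (n : ℕ → ℤ) (hn : StrictMono n) (f : G → ℝ) (hf : AEMeasurable f m) :
    (0 < m (NonconvRotation.rotationSetBdd m n f) → Integrable f m) ∧
      (0 < m (NonconvRotation.rotationSet m n f) → Integrable f m) := by
  have hmain (hpos : 0 < m (NonconvRotation.rotationSetBdd m n f)) : Integrable f m := by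
    by_contra hint
    obtain ⟨g, hfg, hg, hg2⟩ := exists_ae_eq_measurable_comp_add m hf
    let H : AddSubgroup G := AddSubgroup.connectedComponentOfZero G
    have hH : IsOpen (H : Set G) := isOpen_connectedComponent
    have : CompactSpace H :=
      isCompact_iff_compactSpace.1 (isClosed_connectedComponent (x := (0 : G))).isCompact
    have : ConnectedSpace H :=
      isConnected_iff_connectedSpace.1 (isConnected_connectedComponent (x := (0 : G)))
    have : Finite (G ⧸ H) := H.quotient_finite_of_isOpen hH
    have h0 := NonconvRotation.measure_rotationSetBdd_eq_zero m H hH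
      (fun d hd => zsmul_surjective_of_connected hd) hn.injective hg hg2
      (fun h => hint (h.congr hfg.symm))
    exact hpos.ne' (measure_mono_null
      (NonconvRotation.rotationSetBdd_subset_of_ae_eq m n hfg) h0)
  exact ⟨hmain, fun hpos => hmain
    (hpos.trans_le (measure_mono (NonconvRotation.rotationSet_subset_rotationSetBdd m n f)))⟩
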